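/- Theorem. A quasi-order is a reflexive and transitive relation (not necessarily antisymmetric); a quasi-order $\prec$ on $V$ is regarded as a digraph with an arc from $x$ to $y$ whenever $x \prec y$. A complete multidigraph is a digraph, possibly with parallel arcs, that has at least one arc (in some direction) between each pair of distinct vertices. For every pair of positive integers $k$ and $l$ there exists an integer $f(k,l)$ such that the following holds. Let $D=(V,A)$ be a finite complete multidigraph whose arcs are the (disjoint) union of the arcs of $k$ quasi-orders $\prec_1,\dots,\prec_k$ on $V$, where arcs belonging to different quasi-orders may be parallel. Then $V$ contains a family of pairwise disjoint (possibly empty) subsets $S_i^j$, $i\in\{1,\dots,k\}$, $j\in\{1,\dots,l\}$, such that 1. $\bigl|\bigcup_{i,j} S_i^j\bigr| \le f(k,l)$, and 2. for each vertex $v\in V\setminus\bigcup_{i,j}S_i^j$ there is an $i\in\{1,\dots,k\}$ such that for each $j\in\{1,\dots,l\}$ there is an arc of $\prec_i$ from a vertex of $S_i^j$ to $v$, that is, some $s\in S_i^j$ with $s\prec_i v$. -/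

import Mathlib

universe u

/-- A multidigraph on the vertex set `V`: parallel arcs and loops are allowed. -/
structure Multidigraph (V : Type u) where
  /-- the arcs -/
  Arc : Type u
  /-- the start vertex of an arc -/
  source : Arc → V
  /-- the end vertex of an arc -/
  target : Arc → V

namespace Multidigraph

/-- There is at least one arc, in one of the two directions, between each pair of distinct
vertices. -/
def IsComplete {V : Type u} (D : Multidigraph V) : Prop :=
  ∀ x y : V, x ≠ y → ∃ a : D.Arc,
    (D.source a = x ∧ D.target a = y) ∨ (D.source a = y ∧ D.target a = x)

/-- The multidigraph whose arcs are the disjoint union of the relations `r i`: for each `i` and each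
pair with `r i x y` there is one arc from `x` to `y`. Arcs that come from different `i` are
different, so they may be parallel. -/
def ofRelations {V : Type u} {k : ℕ} (r : Fin k → V → V → Prop) : Multidigraph V where
  Arc := Σ i : Fin k, {p : V × V // r i p.1 p.2}
  source a := a.2.1.1
  target a := a.2.1.2

end Multidigraph

namespace QuasiOrderDomination

open Finset Filter Topology
open scoped Classical

/-! Minimax gives a weight under which every vertex has in-neighbourhood of weight at least 1/2,
hence at least 1/(2k) in some colour. Splitting by that colour and recursing, a colour must
eventually repeat; greedy choice against the older weight, combined with transitivity, then
dominates by boundedly many vertices (`exists_domination_bound`). Dominating `kq` times and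
recursing over colours again gives a bounded `Z` such that each outside vertex has, in some colour
`i`, an in-neighbour in `Z` with `q` in-neighbours of colour `i` in `Z`
(`exists_robustly_dominating`). A random splitting of `Z` into `kl` classes meets all these large
in-neighbourhoods in every class, and transitivity passes this on to the outside vertices. -/

/-! ### Minimax weights and greedy domination -/

/-- Every total relation on a finite nonempty type has a probability weight for which each vertex
has in-neighbourhood of weight at least one half. -/
theorem exists_weight_half {V : Type*} [Fintype V] [Nonempty V] (R : V → V → Prop)
    (hR : ∀ x y, R x y ∨ R y x) :
    ∃ w : V → ℝ, (∀ x, 0 ≤ w x) ∧ ∑ x, w x = 1 ∧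
      ∀ v, 1 / 2 ≤ ∑ x with R x v, w x := by
  let M : V → V → ℝ := fun u v => if R u v then 1 else 0
  let f : (V → ℝ) → (V → ℝ) → ℝ := fun x y => ∑ v, ∑ u, x v * (y u * M u v)
  have ne : (stdSimplex ℝ V).Nonempty :=
    ⟨_, single_mem_stdSimplex ℝ (Classical.arbitrary V)⟩
  have lin1 : ∀ y, IsLinearMap ℝ (fun x => f x y) := fun y =>
    { map_add := fun a b => by simp [f, add_mul, sum_add_distrib]
      map_smul := fun c a => by simp [f, mul_assoc, mul_sum] }
  have lin2 : ∀ x, IsLinearMap ℝ (f x) := fun x =>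
    { map_add := fun a b => by simp [f, add_mul, mul_add, sum_add_distrib]
      map_smul := fun c a => by
        simp only [f, Pi.smul_apply, smul_eq_mul, mul_sum]
        exact sum_congr rfl fun _ _ => sum_congr rfl fun _ _ => by ring }
  have cX := convex_stdSimplex ℝ V
  obtain ⟨a, ha, b, hb, hab⟩ := Sion.exists_isSaddlePointOn (f := f) ne cX
    (isCompact_stdSimplex ℝ V)
    (fun y _ => (by fun_prop : Continuous fun x => f x y).lowerSemicontinuous.lowerSemicontinuousOn _)
    (fun y _ => ((lin1 y).mk' _ |>.convexOn cX).quasiconvexOn)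
    cX ne (isCompact_stdSimplex ℝ V)
    (fun x _ => (by fun_prop : Continuous fun y => f x y).upperSemicontinuous.upperSemicontinuousOn _)
    (fun x _ => ((lin2 x).mk' _ |>.concaveOn cX).quasiconcaveOn)
  -- The maximiser may copy the minimiser's strategy `a`; by totality, the payoff plus its transpose
  -- is at least 1.
  have key : 1 / 2 ≤ f a a := by
    have h1 : f a a = ∑ v, ∑ u, a u * (a v * M v u) := by
      simp only [f]; rw [sum_comm]
    have h2 : (∑ v, a v) * (∑ u, a u) ≤ f a a + f a a := by
      nth_rewrite 2 [h1]
      simp only [f]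
      rw [sum_mul_sum, ← sum_add_distrib]
      refine sum_le_sum fun v _ => ?_
      rw [← sum_add_distrib]
      refine sum_le_sum fun u _ => ?_
      have hM : 1 ≤ M u v + M v u := by
        rcases hR u v with h | h <;> simp only [M, h, if_true] <;> split_ifs <;> norm_num
      have := mul_nonneg (ha.1 v) (ha.1 u)
      nlinarith
    rw [ha.2] at h2
    linarith
  refine ⟨b, hb.1, hb.2, fun v => ?_⟩
  have h := hab (Pi.single v 1) (single_mem_stdSimplex ℝ v) a ha
  have h3 : f (Pi.single v 1) b = ∑ x with R x v, b x := by
    simp only [f]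
    rw [sum_eq_single v]
    · simp [M, sum_filter]
    · intro u _ hu; simp [hu]
    · simp
  linarith

theorem exists_weight_half_on {V : Type*} [Fintype V] (R : V → V → Prop)
    (hR : ∀ x y, R x y ∨ R y x) (U : Finset V) (hU : U.Nonempty) :
    ∃ w : V → ℝ, (∀ x, 0 ≤ w x) ∧ ∑ x, w x = 1 ∧ (∀ x, x ∉ U → w x = 0) ∧
      ∀ v ∈ U, 1 / 2 ≤ ∑ x with R x v, w x := by
  have : Nonempty U := hU.to_subtype
  obtain ⟨w, h0, h1, h2⟩ := exists_weight_half (fun x y : U => R x y) fun x y => hR x y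
  let w' : V → ℝ := fun x => if h : x ∈ U then w ⟨x, h⟩ else 0
  have hw' : ∀ x : U, w' x = w x := fun x => by simp [w']
  have hsupp : ∀ x, x ∉ U → w' x = 0 := fun x hx => by simp [w', hx]
  refine ⟨w', fun x => ?_, ?_, hsupp, fun v hv => ?_⟩
  · simp only [w']; split_ifs
    · exact h0 _
    · exact le_rfl
  · rw [← h1, ← sum_subset (subset_univ U) fun x _ hx => hsupp x hx, ← sum_coe_sort]
    exact sum_congr rfl fun x _ => hw' x
  · refine (h2 ⟨v, hv⟩).trans_eq ?_
    rw [sum_filter, sum_filter, ← sum_subset (subset_univ U) fun x _ hx => by simp [hsupp x hx],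
      ← sum_coe_sort U fun x => if R x v then w' x else 0]
    exact sum_congr rfl fun x _ => by rw [hw']

/-- Greedy choice: if every vertex of `A` has in-neighbourhood of `w`-weight at least `δ`, then
some `N` vertices dominate all of `A` but a part of relative `μ`-weight `(1 - δ) ^ N`. -/
theorem exists_dominating_most {V : Type*} [Fintype V] (R : V → V → Prop) (w μ : V → ℝ)
    (w0 : ∀ x, 0 ≤ w x) (w1 : ∑ x, w x = 1) (μ0 : ∀ x, 0 ≤ μ x) {δ : ℝ} (hδ : δ ≤ 1)
    (A : Finset V) (hA : ∀ v ∈ A, δ ≤ ∑ x with R x v, w x) (N : ℕ) :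
    ∃ S : Finset V, #S ≤ N ∧
      ∑ v ∈ A with ∀ s ∈ S, ¬ R s v, μ v ≤ (1 - δ) ^ N * ∑ v ∈ A, μ v := by
  induction N with
  | zero => exact ⟨∅, by simp⟩
  | succ N ih =>
    obtain ⟨S, hS, h⟩ := ih
    set B := A.filter fun v => ∀ s ∈ S, ¬ R s v
    -- A vertex drawn with law `w` dominates, on average, at least a fraction `δ` of the `μ`-mass of
    -- `B`.
    have avg : ∃ s, δ * ∑ v ∈ B, μ v ≤ ∑ v ∈ B with R s v, μ v := by
      by_contra! hc
      have e1 : δ * ∑ v ∈ B, μ v ≤ ∑ s, w s * ∑ v ∈ B with R s v, μ v := by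
        have : ∑ s, w s * ∑ v ∈ B with R s v, μ v = ∑ v ∈ B, μ v * ∑ x with R x v, w x := by
          simp only [sum_filter, mul_sum]
          rw [sum_comm]
          refine sum_congr rfl fun _ _ => sum_congr rfl fun _ _ => ?_
          split_ifs <;> ring
        rw [this, mul_sum]
        refine sum_le_sum fun v hv => ?_
        rw [mul_comm]
        exact mul_le_mul_of_nonneg_left (hA v (mem_filter.1 hv).1) (μ0 v)
      obtain ⟨s, _, hs⟩ : ∃ s ∈ univ, 0 < w s := by
        refine exists_lt_of_sum_lt (f := fun _ => (0 : ℝ)) ?_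
        simp [w1]
      have e2 : ∑ s, w s * ∑ v ∈ B with R s v, μ v < ∑ s, w s * (δ * ∑ v ∈ B, μ v) :=
        sum_lt_sum (fun s _ => mul_le_mul_of_nonneg_left (hc s).le (w0 s))
          ⟨s, mem_univ _, mul_lt_mul_of_pos_left (hc s) hs⟩
      rw [← sum_mul, w1, one_mul] at e2
      exact absurd e2 (not_lt.2 e1)
    obtain ⟨s, hs⟩ := avg
    refine ⟨insert s S, (card_insert_le _ _).trans (by omega), ?_⟩
    have e : (A.filter fun v => ∀ t ∈ insert s S, ¬ R t v) = B.filter fun v => ¬ R s v := by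
      ext v; simp only [B, mem_filter, mem_insert, forall_eq_or_imp]; tauto
    rw [e]
    have := sum_filter_add_sum_filter_not B (fun v => R s v) μ
    calc ∑ v ∈ B with ¬ R s v, μ v ≤ (1 - δ) * ∑ v ∈ B, μ v := by linarith
      _ ≤ (1 - δ) * ((1 - δ) ^ N * ∑ v ∈ A, μ v) :=
        mul_le_mul_of_nonneg_left h (by linarith)
      _ = _ := by ring

/-! ### Bounded domination by a union of transitive relations -/

section Colours

variable {ι : Type*} [Fintype ι] [Nonempty ι]

/-- Domination of a set `U` on which the colours in `C` already have heavy in-neighbourhoods. -/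
theorem exists_dominating_of_heavy {V : Type*} [Fintype V] (r : ι → V → V → Prop)
    (htrans : ∀ i x y z, r i x y → r i y z → r i x z)
    (htot : ∀ x y, (∃ i, r i x y) ∨ ∃ i, r i y x)
    {N : ℕ} (hN : (1 - 1 / (2 * Fintype.card ι : ℝ)) ^ N < 1 / (2 * Fintype.card ι))
    (n : ℕ) (C : Finset ι) (hC : #Cᶜ ≤ n) (U : Finset V)
    (hU : ∀ c ∈ C, ∃ w : V → ℝ, (∀ x, 0 ≤ w x) ∧ ∑ x, w x = 1 ∧
      ∀ v ∈ U, 1 / (2 * Fintype.card ι : ℝ) ≤ ∑ x with r c x v, w x) :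
    ∃ S : Finset V, #S ≤ Fintype.card ι ^ (n + 1) * N ∧ ∀ v ∈ U, ∃ s ∈ S, ∃ i, r i s v := by
  have kpos : 0 < Fintype.card ι := Fintype.card_pos
  have kpos' : (1 : ℝ) ≤ Fintype.card ι := by exact_mod_cast kpos
  induction n generalizing C U with
  | zero => ?_
  | succ n ih => ?_
  all_goals
    rcases U.eq_empty_or_nonempty with rfl | hne
    · exact ⟨∅, by simp⟩
    obtain ⟨w, w0, w1, wU, wh⟩ := exists_weight_half_on (fun x y => ∃ i, r i x y) htot U hne
    set δ : ℝ := 1 / (2 * Fintype.card ι) with hδ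
    have hδ1 : δ ≤ 1 := by rw [hδ, div_le_one] <;> linarith
    have hpart : ∀ v ∈ U, ∃ i, δ ≤ ∑ x with r i x v, w x := by
      intro v hv
      by_contra! hc
      have h1 : ∑ x with (∃ i, r i x v), w x ≤ ∑ i, ∑ x with r i x v, w x := by
        simp only [sum_filter]
        rw [sum_comm]
        refine sum_le_sum fun x _ => ?_
        have hnn : ∀ i ∈ univ, 0 ≤ if r i x v then w x else 0 := fun i _ => by
          split_ifs
          · exact w0 x
          · exact le_rfl
        split_ifs with h
        · obtain ⟨i, hi⟩ := h
          refine le_trans ?_ (single_le_sum hnn (mem_univ i))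
          simp [hi]
        · exact sum_nonneg hnn
      have h2 : ∑ i, ∑ x with r i x v, w x < ∑ _i : ι, δ :=
        sum_lt_sum_of_nonempty univ_nonempty fun i _ => hc i
      have h3 : ∑ _i : ι, δ = 1 / 2 := by
        rw [sum_const, card_univ, nsmul_eq_mul, hδ]; field_simp
      have h4 : 1 / 2 ≤ ∑ x with (∃ i, r i x v), w x := by convert wh v hv
      linarith
    -- The older weight `u` guides the greedy choice and the new weight `w` measures what is missed.
    -- The missed part has `w`-mass below `δ`, so a `j`-in-neighbourhood of `w`-mass at least `δ`
    -- contains a vertex dominated in colour `j`; transitivity finishes.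
    have old : ∀ j ∈ C, ∃ S : Finset V, #S ≤ N ∧
        ∀ v ∈ U, δ ≤ ∑ x with r j x v, w x → ∃ s ∈ S, ∃ i, r i s v := by
      intro j hj
      obtain ⟨u, u0, u1, hu⟩ := hU j hj
      obtain ⟨S, hS, hd⟩ := exists_dominating_most (r j) u w u0 u1 w0 hδ1 U hu N
      refine ⟨S, hS, fun v _ hjv => ?_⟩
      by_contra! hc
      have hle : ∑ x with r j x v, w x ≤ ∑ x ∈ U with ∀ s ∈ S, ¬ r j s x, w x := by
        rw [← sum_filter_of_ne (p := fun x => x ∈ U) fun x _ hx => by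
          by_contra h; exact hx (wU x h)]
        refine sum_le_sum_of_subset_of_nonneg (fun x hx => ?_) fun x _ _ => w0 x
        simp only [mem_filter, mem_univ, true_and] at hx ⊢
        exact ⟨hx.2, fun s hs h => hc s hs j (htrans j _ _ _ h hx.1)⟩
      have hw : ∑ x ∈ U, w x = 1 := by
        rw [← w1]; exact sum_subset (subset_univ U) fun x _ hx => wU x hx
      rw [hw, mul_one] at hd
      linarith
  · have hall : ∀ j, j ∈ C := by
      intro j
      by_contra h
      have : j ∈ Cᶜ := mem_compl.2 h
      rw [card_eq_zero.1 (Nat.le_zero.1 hC)] at this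
      simp at this
    choose S hS hd using fun j => old j (hall j)
    refine ⟨univ.biUnion S, ?_, fun v hv => ?_⟩
    · simpa using card_biUnion_le_card_mul univ S N fun j _ => hS j
    · obtain ⟨i, hi⟩ := hpart v hv
      obtain ⟨s, hs, h⟩ := hd i v hv hi
      exact ⟨s, mem_biUnion.2 ⟨i, mem_univ _, hs⟩, h⟩
  · have each : ∀ j, ∃ S : Finset V, #S ≤ Fintype.card ι ^ (n + 1) * N ∧
        ∀ v ∈ U, δ ≤ ∑ x with r j x v, w x → ∃ s ∈ S, ∃ i, r i s v := by
      intro j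
      by_cases hj : j ∈ C
      · obtain ⟨S, hS, h⟩ := old j hj
        exact ⟨S, hS.trans (Nat.le_mul_of_pos_left _ (pow_pos kpos _)), h⟩
      · obtain ⟨S, hS, h⟩ := ih (insert j C)
          (by rw [compl_insert, card_erase_of_mem (mem_compl.2 hj)]; omega)
          (U.filter fun v => δ ≤ ∑ x with r j x v, w x) fun c hc => by
            rcases mem_insert.1 hc with rfl | hc
            · exact ⟨w, w0, w1, fun v hv => (mem_filter.1 hv).2⟩
            · obtain ⟨u, u0, u1, hu⟩ := hU c hc
              exact ⟨u, u0, u1, fun v hv => hu v (mem_filter.1 hv).1⟩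
        exact ⟨S, hS, fun v hv hjv => h v (mem_filter.2 ⟨hv, hjv⟩)⟩
    choose S hS hd using each
    refine ⟨univ.biUnion S, ?_, fun v hv => ?_⟩
    · refine (card_biUnion_le_card_mul univ S _ fun j _ => hS j).trans_eq ?_
      rw [card_univ]; ring
    · obtain ⟨i, hi⟩ := hpart v hv
      obtain ⟨s, hs, h⟩ := hd i v hv hi
      exact ⟨s, mem_biUnion.2 ⟨i, mem_univ _, hs⟩, h⟩

variable (ι) in
/-- The domination number of a complete multidigraph that is a union of quasi-orders indexed by `ι`
is bounded in terms of `ι`. -/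
theorem exists_domination_bound :
    ∃ F : ℕ, ∀ (V : Type*) [Fintype V] (r : ι → V → V → Prop),
      (∀ i x y z, r i x y → r i y z → r i x z) →
      (∀ x y, (∃ i, r i x y) ∨ ∃ i, r i y x) →
      ∀ U : Finset V, ∃ X ⊆ U, #X ≤ F ∧ ∀ v ∈ U, ∃ x ∈ X, ∃ i, r i x v := by
  have kpos : (1 : ℝ) ≤ Fintype.card ι := by exact_mod_cast Fintype.card_pos (α := ι)
  have hδ : (0 : ℝ) < 1 / (2 * Fintype.card ι) := by positivity
  obtain ⟨N, hN⟩ := exists_pow_lt_of_lt_one hδ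
    (show (1 - 1 / (2 * Fintype.card ι : ℝ)) < 1 by linarith)
  refine ⟨Fintype.card ι ^ (#(∅ : Finset ι)ᶜ + 1) * N, fun V _ r htrans htot U => ?_⟩
  -- Passing to the subtype `U` forces the dominating vertices to lie in `U`.
  obtain ⟨S, hS, h⟩ := exists_dominating_of_heavy (fun i (x y : U) => r i x y)
    (fun i x y z => htrans i x y z) (fun x y => htot x y) hN _ ∅ le_rfl univ (by simp)
  refine ⟨S.map (Function.Embedding.subtype _), fun x hx => ?_, by simpa using hS,
    fun v hv => ?_⟩
  · obtain ⟨y, _, rfl⟩ := mem_map.1 hx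
    exact y.2
  · obtain ⟨s, hs, hi⟩ := h ⟨v, hv⟩ (mem_univ _)
    exact ⟨s, mem_map.2 ⟨s, hs, rfl⟩, hi⟩

/-! ### Multiple and robust domination -/

/-- Repeatedly removing dominating sets yields a bounded set that dominates many times. -/
theorem exists_multiply_dominating {V : Type*} (R : V → V → Prop) {F : ℕ}
    (hdom : ∀ U : Finset V, ∃ X ⊆ U, #X ≤ F ∧ ∀ v ∈ U, ∃ x ∈ X, R x v)
    (U : Finset V) (m : ℕ) :
    ∃ Z ⊆ U, #Z ≤ m * F ∧ ∀ v ∈ U, v ∉ Z → m ≤ #{x ∈ Z | R x v} := by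
  induction m with
  | zero => exact ⟨∅, by simp⟩
  | succ m ih =>
    obtain ⟨Z, hZU, hZ, h⟩ := ih
    obtain ⟨X, hXU, hX, hd⟩ := hdom (U \ Z)
    refine ⟨Z ∪ X, union_subset hZU (hXU.trans sdiff_subset), ?_, fun v hv hvn => ?_⟩
    · have := card_union_le Z X
      rw [Nat.succ_mul]; omega
    · rw [mem_union, not_or] at hvn
      obtain ⟨x, hx, hxv⟩ := hd v (mem_sdiff.2 ⟨hv, hvn.1⟩)
      refine lt_of_le_of_lt (h v hv hvn.1) (card_lt_card ?_)
      rw [ssubset_iff_of_subset (filter_subset_filter _ subset_union_left)]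
      refine ⟨x, mem_filter.2 ⟨mem_union_right _ hx, hxv⟩, fun hx' => ?_⟩
      exact (mem_sdiff.1 (hXU hx)).2 (mem_filter.1 hx').1

/-- A bounded set `Z` such that each vertex outside `Z` has, in some colour `i`, an in-neighbour in
`Z` which itself has many in-neighbours of colour `i` in `Z`, unless `i ∈ C`. -/
theorem exists_robustly_dominating {V : Type*} (r : ι → V → V → Prop) {F : ℕ}
    (hdom : ∀ U : Finset V, ∃ X ⊆ U, #X ≤ F ∧ ∀ v ∈ U, ∃ x ∈ X, ∃ i, r i x v)
    {q : ℕ} (hq : 0 < q) (n : ℕ) (C : Finset ι) (hC : #Cᶜ ≤ n) (U : Finset V) :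
    ∃ Z ⊆ U, #Z ≤ (n + 1) * Fintype.card ι ^ (n + 1) * F * q ∧
      ∀ v ∈ U, v ∉ Z → ∃ i, ∃ x ∈ Z, r i x v ∧ (i ∈ C ∨ q ≤ #{y ∈ Z | r i y x}) := by
  have kpos : 0 < Fintype.card ι := Fintype.card_pos
  induction n generalizing C U with
  | zero => ?_
  | succ n ih => ?_
  all_goals
    obtain ⟨Z, hZU, hZ, hm⟩ :=
      exists_multiply_dominating (fun x y => ∃ i, r i x y) hdom U (Fintype.card ι * q)
    have hpart : ∀ v ∈ U, v ∉ Z → ∃ i, q ≤ #{x ∈ Z | r i x v} := by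
      intro v hv hvn
      by_contra! hc
      have h1 : #{x ∈ Z | ∃ i, r i x v} ≤ ∑ i, #{x ∈ Z | r i x v} := by
        refine le_trans (card_le_card fun x hx => ?_) card_biUnion_le
        obtain ⟨hx, i, hi⟩ := mem_filter.1 hx
        exact mem_biUnion.2 ⟨i, mem_univ _, mem_filter.2 ⟨hx, hi⟩⟩
      have h2 : ∑ i, #{x ∈ Z | r i x v} < ∑ _i : ι, q :=
        sum_lt_sum_of_nonempty univ_nonempty fun i _ => hc i
      simp only [sum_const, card_univ, smul_eq_mul] at h2
      have h3 : Fintype.card ι * q ≤ #{x ∈ Z | ∃ i, r i x v} := by convert hm v hv hvn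
      omega
    have hex : ∀ i v, q ≤ #{x ∈ Z | r i x v} → ∃ x ∈ Z, r i x v := by
      intro i v h
      obtain ⟨x, hx⟩ := card_pos.1 (hq.trans_le h)
      exact ⟨x, mem_filter.1 hx⟩
  · refine ⟨Z, hZU, hZ.trans_eq (by ring), fun v hv hvn => ?_⟩
    obtain ⟨i, hi⟩ := hpart v hv hvn
    obtain ⟨x, hx, hxv⟩ := hex i v hi
    refine ⟨i, x, hx, hxv, Or.inl ?_⟩
    by_contra h
    have : i ∈ Cᶜ := mem_compl.2 h
    rw [card_eq_zero.1 (Nat.le_zero.1 hC)] at this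
    simp at this
  -- For `j ∉ C`, `Y` is chosen among the vertices with `q` in-neighbours of colour `j` in `Z`, so
  -- colour `j` is exempt in the recursive call.
  · have each : ∀ j, ∃ Y ⊆ U, #Y ≤ (n + 1) * Fintype.card ι ^ (n + 1) * F * q ∧
        (∀ x ∈ Y, q ≤ #{y ∈ Z | r j y x}) ∧
        (j ∉ C → ∀ v ∈ U, q ≤ #{x ∈ Z | r j x v} → v ∉ Y →
          ∃ i, ∃ x ∈ Y, r i x v ∧ (i ∈ insert j C ∨ q ≤ #{y ∈ Y | r i y x})) := by
      intro j
      by_cases hj : j ∈ C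
      · exact ⟨∅, by simp [hj]⟩
      · obtain ⟨Y, hYU, hY, h⟩ := ih (insert j C)
          (by rw [compl_insert, card_erase_of_mem (mem_compl.2 hj)]; omega)
          (U.filter fun v => q ≤ #{x ∈ Z | r j x v})
        exact ⟨Y, hYU.trans (filter_subset _ _), hY, fun x hx => (mem_filter.1 (hYU hx)).2,
          fun _ v hv hvq hvn => h v (mem_filter.2 ⟨hv, hvq⟩) hvn⟩
    choose Y hYU hY hYZ hd using each
    refine ⟨Z ∪ univ.biUnion Y, union_subset hZU (biUnion_subset.2 fun j _ => hYU j), ?_,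
      fun v hv hvn => ?_⟩
    · have h1 := card_union_le Z (univ.biUnion Y)
      have h2 := card_biUnion_le_card_mul univ Y _ fun j _ => hY j
      rw [card_univ] at h2
      have h3 : Fintype.card ι * q * F ≤ Fintype.card ι ^ (n + 2) * F * q := by
        have : Fintype.card ι ≤ Fintype.card ι ^ (n + 2) := Nat.le_self_pow (by omega) _
        calc Fintype.card ι * q * F = Fintype.card ι * F * q := by ring
          _ ≤ _ := by gcongr
      calc _ ≤ Fintype.card ι ^ (n + 2) * F * q +
            Fintype.card ι * ((n + 1) * Fintype.card ι ^ (n + 1) * F * q) := by omega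
        _ = _ := by ring
    · rw [mem_union, not_or] at hvn
      obtain ⟨j, hj⟩ := hpart v hv hvn.1
      obtain ⟨z, hz, hzv⟩ := hex j v hj
      by_cases hjC : j ∈ C
      · exact ⟨j, z, mem_union_left _ hz, hzv, Or.inl hjC⟩
      · obtain ⟨i, x, hx, hxv, h⟩ := hd j hjC v hv hj fun h =>
          hvn.2 (mem_biUnion.2 ⟨j, mem_univ _, h⟩)
        have hYsub : Y j ⊆ Z ∪ univ.biUnion Y := fun y hy =>
          mem_union_right _ (mem_biUnion.2 ⟨j, mem_univ _, hy⟩)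
        refine ⟨i, x, hYsub hx, hxv, ?_⟩
        rcases h with h | h
        · rcases mem_insert.1 h with rfl | h
          · exact Or.inr ((hYZ i x hx).trans
              (card_le_card (filter_subset_filter _ subset_union_left)))
          · exact Or.inl h
        · exact Or.inr (h.trans (card_le_card (filter_subset_filter _ hYsub)))

end Colours

/-! ### Random splitting -/

/-- A map from `V` to `K` that is onto on every member of a small family of large sets. -/
theorem exists_map_surjOn_family {V K T : Type*} [Fintype V] [Fintype K] [Nonempty K]
    (I : Finset T) (A : T → Finset V) {q : ℕ} (hA : ∀ t ∈ I, q ≤ #(A t))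
    (hq : #I * Fintype.card K * (1 - 1 / (Fintype.card K : ℝ)) ^ q < 1) :
    ∃ g : V → K, ∀ t ∈ I, ∀ c, ∃ y ∈ A t, g y = c := by
  set κ : ℝ := (Fintype.card K : ℝ) with hκ
  have κ1 : 1 ≤ κ := by rw [hκ]; exact_mod_cast Fintype.card_pos (α := K)
  have ρ0 : 0 ≤ 1 - 1 / κ := by
    have : 1 / κ ≤ 1 := by rw [div_le_one] <;> linarith
    linarith
  have ρ1 : 1 - 1 / κ ≤ 1 := by
    have : 0 < 1 / κ := by positivity
    linarith
  -- The maps that miss the value `p.2` on `A p.1`; the union bound is done by counting.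
  let bad : T × K → Finset (V → K) := fun p =>
    Fintype.piFinset fun v => if v ∈ A p.1 then univ.erase p.2 else univ
  have hbad : ∀ p ∈ I ×ˢ (univ : Finset K),
      (#(bad p) : ℝ) ≤ κ ^ Fintype.card V * (1 - 1 / κ) ^ q := by
    intro p hp
    have h1 : (#(bad p) : ℝ) = ∏ v : V, κ * if v ∈ A p.1 then 1 - 1 / κ else 1 := by
      simp only [bad, Fintype.card_piFinset, Nat.cast_prod]
      refine prod_congr rfl fun v _ => ?_
      split_ifs
      · rw [card_erase_of_mem (mem_univ _), card_univ, Nat.cast_sub Fintype.card_pos]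
        field_simp
        simp [hκ]
      · simp [hκ]
    rw [h1, prod_mul_distrib, prod_const, card_univ, prod_ite, prod_const, prod_const, one_pow,
      mul_one]
    refine mul_le_mul_of_nonneg_left (pow_le_pow_of_le_one ρ0 ρ1 ?_) (by positivity)
    simpa using hA p.1 (mem_product.1 hp).1
  have hlt : #((I ×ˢ (univ : Finset K)).biUnion bad) < #(univ : Finset (V → K)) := by
    have h1 : (#((I ×ˢ (univ : Finset K)).biUnion bad) : ℝ) ≤
        ∑ p ∈ I ×ˢ (univ : Finset K), (#(bad p) : ℝ) := by exact_mod_cast card_biUnion_le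
    have h2 := sum_le_card_nsmul _ _ _ hbad
    rw [card_product, card_univ, nsmul_eq_mul, Nat.cast_mul, ← hκ] at h2
    have h3 : (#I * κ) * (κ ^ Fintype.card V * (1 - 1 / κ) ^ q) < κ ^ Fintype.card V := by
      have : 0 < κ ^ Fintype.card V := by positivity
      nlinarith
    have h4 : (#(univ : Finset (V → K)) : ℝ) = κ ^ Fintype.card V := by
      rw [card_univ, Fintype.card_fun]; simp [hκ]
    have : (#((I ×ˢ (univ : Finset K)).biUnion bad) : ℝ) < #(univ : Finset (V → K)) := by
      rw [h4]; linarith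
    exact_mod_cast this
  obtain ⟨g, _, hg⟩ := exists_mem_notMem_of_card_lt_card hlt
  refine ⟨g, fun t ht c => ?_⟩
  by_contra! hc
  refine hg (mem_biUnion.2 ⟨(t, c), mem_product.2 ⟨ht, mem_univ _⟩, ?_⟩)
  refine Fintype.mem_piFinset.2 fun v => ?_
  split_ifs with h
  · exact mem_erase.2 ⟨hc v h, mem_univ _⟩
  · exact mem_univ _

/-- The size of `Z`, and so the number of sets to be hit, grows linearly in `q`, while the chance of
missing a class decays exponentially; hence `q` can be fixed before `Z`. -/
theorem exists_pos_mul_pow_lt_one (a : ℕ) {κ : ℕ} (hκ : 0 < κ) :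
    ∃ q : ℕ, 0 < q ∧ ((a * q : ℕ) : ℝ) * (1 - 1 / (κ : ℝ)) ^ q < 1 := by
  have κ1 : (1 : ℝ) ≤ κ := by exact_mod_cast hκ
  have h0 : 1 / (κ : ℝ) ≤ 1 := by rw [div_le_one] <;> linarith
  have h1 : 0 < 1 / (κ : ℝ) := by positivity
  have h := (tendsto_self_mul_const_pow_of_lt_one (r := 1 - 1 / (κ : ℝ)) (by linarith)
    (by linarith)).const_mul (a : ℝ)
  rw [mul_zero] at h
  obtain ⟨q, hq, hq0⟩ := ((h.eventually_lt_const one_pos).and (eventually_gt_atTop 0)).exists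
  refine ⟨q, hq0, ?_⟩
  push_cast
  rwa [mul_assoc]

end QuasiOrderDomination

/-! ### Assembly -/

theorem mainTheorem2 (k l : ℕ) (hk : 0 < k) (hl : 0 < l) :
    ∃ f : ℕ, ∀ (V : Type u) [Finite V] (r : Fin k → V → V → Prop),
      (∀ i, IsPreorder V (r i)) →
      (Multidigraph.ofRelations r).IsComplete →
      ∃ S : Fin k → Fin l → Set V,
        (Pairwise fun p q : Fin k × Fin l => Disjoint (S p.1 p.2) (S q.1 q.2)) ∧
        (⋃ i, ⋃ j, S i j).ncard ≤ f ∧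
        ∀ v : V, v ∉ (⋃ i, ⋃ j, S i j) →
          ∃ i : Fin k, ∀ j : Fin l, ∃ s ∈ S i j, r i s v := by
  classical
  have : Nonempty (Fin k) := ⟨⟨0, hk⟩⟩
  have : Nonempty (Fin l) := ⟨⟨0, hl⟩⟩
  obtain ⟨F, hF⟩ := QuasiOrderDomination.exists_domination_bound.{_, u} (Fin k)
  obtain ⟨q, hq, hq1⟩ := QuasiOrderDomination.exists_pos_mul_pow_lt_one
    ((k + 1) * k ^ (k + 1) * F * k * (k * l)) (Nat.mul_pos hk hl)
  refine ⟨(k + 1) * k ^ (k + 1) * F * q, fun V _ r hr hD => ?_⟩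
  have := Fintype.ofFinite V
  have htrans : ∀ i x y z, r i x y → r i y z → r i x z := fun i _ _ _ => (hr i).trans _ _ _
  have htot : ∀ x y, (∃ i, r i x y) ∨ ∃ i, r i y x := by
    intro x y
    by_cases hxy : x = y
    · subst hxy
      exact Or.inl ⟨⟨0, hk⟩, (hr _).refl x⟩
    · obtain ⟨⟨i, p, hp⟩, ⟨rfl, rfl⟩ | ⟨rfl, rfl⟩⟩ := hD x y hxy
      · exact Or.inl ⟨i, hp⟩
      · exact Or.inr ⟨i, hp⟩
  obtain ⟨Z, -, hZ, hd⟩ := QuasiOrderDomination.exists_robustly_dominating r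
    (hF V r htrans htot) hq k ∅ (by simp) Finset.univ
  rw [Fintype.card_fin] at hZ
  -- Indexes the in-neighbourhoods in `Z` that every class must meet.
  let I : Finset (V × Fin k) :=
    (Z ×ˢ Finset.univ).filter fun p => q ≤ (Z.filter fun y => r p.2 y p.1).card
  have hI : I.card ≤ (k + 1) * k ^ (k + 1) * F * q * k := by
    refine (Finset.card_filter_le _ _).trans ?_
    rw [Finset.card_product, Finset.card_univ, Fintype.card_fin]
    exact Nat.mul_le_mul_right k hZ
  obtain ⟨g, hg⟩ := QuasiOrderDomination.exists_map_surjOn_family (K := Fin k × Fin l) I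
    (fun p => Z.filter fun y => r p.2 y p.1) (q := q)
    (fun p hp => (Finset.mem_filter.1 hp).2) (by
      rw [Fintype.card_prod, Fintype.card_fin, Fintype.card_fin]
      refine lt_of_le_of_lt ?_ hq1
      have hρ : (0 : ℝ) ≤ 1 - 1 / ((k * l : ℕ) : ℝ) := by
        have : (1 : ℝ) ≤ ((k * l : ℕ) : ℝ) := by exact_mod_cast Nat.mul_pos hk hl
        have : 1 / ((k * l : ℕ) : ℝ) ≤ 1 := by rw [div_le_one] <;> linarith
        linarith
      refine mul_le_mul_of_nonneg_right ?_ (pow_nonneg hρ q)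
      have := Nat.mul_le_mul_right (k * l) hI
      exact_mod_cast this.trans_eq (by ring))
  have hU : (⋃ i, ⋃ j, {x | x ∈ Z ∧ g x = (i, j)}) = (Z : Set V) := by
    ext x
    simp only [Set.mem_iUnion, Set.mem_ofPred_eq, Finset.mem_coe]
    exact ⟨fun ⟨_, _, h, _⟩ => h, fun h => ⟨(g x).1, (g x).2, h, rfl⟩⟩
  refine ⟨fun i j => {x | x ∈ Z ∧ g x = (i, j)}, fun a b hab => ?_, ?_, fun v hv => ?_⟩
  · exact Set.disjoint_left.2 fun x hx hx' => hab (hx.2.symm.trans hx'.2)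
  · rw [hU, Set.ncard_coe_finset]
    exact hZ
  · rw [hU, Finset.mem_coe] at hv
    obtain ⟨i, x, hx, hxv, h⟩ := hd v (Finset.mem_univ v) hv
    have hxq := h.resolve_left (by simp)
    refine ⟨i, fun j => ?_⟩
    obtain ⟨y, hy, hgy⟩ := hg (x, i) (Finset.mem_filter.2
      ⟨Finset.mem_product.2 ⟨hx, Finset.mem_univ i⟩, by convert hxq⟩) (i, j)
    obtain ⟨hyZ, hyx⟩ := Finset.mem_filter.1 hy
    exact ⟨y, ⟨hyZ, hgy⟩, htrans i _ _ _ hyx hxv⟩
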